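/- An ordered set partition (hierarchy) of $n$ labeled elements is a finite sequence of nonempty, pairwise disjoint blocks covering the $n$ elements; its first block is the bottom level, and the elements of the $r$-th block are said to have rank $r$. Let $B_n$ (the ordered Bell number) be the number of ordered set partitions of $n$ labeled elements. For $n \ge 1$ let $a_n$ be the expected rank of $x$, where $X$ is a uniformly random ordered set partition of $n$ labeled elements and $x$ is a uniformly random one of the $n$ elements, chosen independently of $X$; put $a_0 = 0$. Let $S(n,i)$ denote the Stirling numbers of the second kind. Then: 1. For every $n \ge 1$, $$a_n = \frac{1}{2B_n}\sum_{i=1}^{n} (i+1)!\, S(n,i).$$ 2. As formal power series, $$\sum_{n\ge 0} a_n B_n \frac{x^n}{n!} = -\frac12\,\frac{(e^x-1)(e^x-3)}{(e^x-2)^2}.$$ 3. As $n \to \infty$, $$B_n \sim \frac{n!}{2(\log 2)^{n+1}}, \qquad a_n B_n \sim n!\,\frac{n}{8(\log 2)^{n+2}}, \qquad a_n \sim \frac{n}{4\log 2}.$$ 4. Numerically, $\frac{1}{4\log 2} = 0.36067\ldots$, that is, $0.36067 \le \frac{1}{4 \log 2} < 0.36068$. -/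

import Mathlib

open Asymptotics Filter

/-- An ordered set partition (hierarchy) of `α`: a finite sequence of nonempty, pairwise disjoint
blocks that cover `α`. The block of index `0` is the bottom level. -/
structure OrderedSetPartition (α : Type*) where
  /-- the number of levels -/
  height : ℕ
  /-- the levels, from the bottom upwards -/
  block : Fin height → Finset α
  block_nonempty : ∀ i, (block i).Nonempty
  block_disjoint : ∀ i j, i ≠ j → Disjoint (block i) (block j)
  exists_mem_block : ∀ x, ∃ i, x ∈ block i

namespace OrderedSetPartition

/-- The index of the level that contains `x`, counted from `0`. -/
noncomputable def level {α : Type*} (X : OrderedSetPartition α) (x : α) : Fin X.height :=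
  Classical.choose (X.exists_mem_block x)

/-- The rank of `x`: elements of the bottom level have rank `1`, those of the next level
rank `2`, and so on. -/
noncomputable def rank {α : Type*} (X : OrderedSetPartition α) (x : α) : ℕ :=
  (X.level x : ℕ) + 1

theorem mem_block_iff {α : Type*} (X : OrderedSetPartition α) (x : α) (i : Fin X.height) :
    x ∈ X.block i ↔ X.level x = i := by
  have hx : x ∈ X.block (X.level x) := Classical.choose_spec (X.exists_mem_block x)
  constructor
  · intro h
    by_contra hne
    exact Finset.disjoint_left.mp (X.block_disjoint _ _ hne) hx h
  · rintro rfl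
    exact hx

theorem height_le_card {α : Type*} [Fintype α] (X : OrderedSetPartition α) :
    X.height ≤ Fintype.card α := by
  have h : Function.Surjective X.level := fun i => by
    obtain ⟨x, hx⟩ := X.block_nonempty i
    exact ⟨x, (X.mem_block_iff x i).mp hx⟩
  simpa using Fintype.card_le_of_surjective _ h

instance {α : Type*} [Finite α] : Finite (OrderedSetPartition α) := by
  classical
  have := Fintype.ofFinite α
  let F : OrderedSetPartition α → (h : Fin (Fintype.card α + 1)) × (Fin h → Finset α) :=
    fun X => ⟨⟨X.height, Nat.lt_succ_of_le X.height_le_card⟩, X.block⟩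
  refine Finite.of_injective F ?_
  rintro ⟨h, b, _, _, _⟩ ⟨h', b', _, _, _⟩ hF
  simp only [F, Sigma.mk.injEq, Fin.mk.injEq] at hF
  obtain ⟨rfl, hb⟩ := hF
  obtain rfl := eq_of_heq hb
  rfl

noncomputable instance {α : Type*} [Finite α] : Fintype (OrderedSetPartition α) :=
  Fintype.ofFinite _

end OrderedSetPartition

/-- The ordered Bell number `B_n`: the number of ordered set partitions of `n` labeled elements. -/
noncomputable def orderedBell (n : ℕ) : ℕ :=
  Fintype.card (OrderedSetPartition (Fin n))

/-- The expected rank `a_n` of a uniformly random element `x` of a uniformly random ordered set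
partition `X` of `n` labeled elements: the average of `X.rank x` over all `B_n * n` pairs `(X, x)`.
For `n = 0` there are no pairs and the value is `0`. -/
noncomputable def averageRank (n : ℕ) : ℝ :=
  (∑ X : OrderedSetPartition (Fin n), ∑ x : Fin n, (X.rank x : ℝ)) / ((orderedBell n : ℝ) * n)

/-! An ordered set partition with `k` levels is a surjection onto `Fin k`, so there are `k! S(n,k)`
of them. Turning a hierarchy upside down shows that the mean rank at fixed height is `(k+1)/2`,
which gives the exact formula. The Stirling recurrence turns the sum of `(k+1)! S(n,k)` into Bell
numbers: `a_n B_n = (B_{n+1} + B_n)/4` for `n ≥ 1`. Hence the generating function of `a_n B_n` comes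
from `B = 1/(2 - e^x)` and its derivative, and its asymptotics from those of `B_n`.

For `B_n`, the function `(log 2 - z)/(2 - e^z)` is analytic on the unit disc, which contains `log
2`. The partial sums of its Taylor series at `log 2` telescope to `B_n (log 2)^(n+1) / n!`, so this
tends to the value there, `1/2`. -/

/-! ### Counting surjections -/

theorem surjective_cons_iff {β : Type*} {n : ℕ} (b : β) (t : Fin n → β) :
    Function.Surjective (Fin.cons b t : Fin (n + 1) → β) ↔
      Function.Surjective t ∨ Set.range t = {b}ᶜ := by
  rw [← Set.range_eq_univ, Fin.range_cons, ← Set.range_eq_univ]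
  by_cases hb : b ∈ Set.range t
  · rw [Set.insert_eq_of_mem hb]
    refine ⟨Or.inl, fun h => h.resolve_right fun h => ?_⟩
    rw [h] at hb
    exact hb rfl
  · constructor
    · intro h
      right
      ext x
      have hx : x ∈ insert b (Set.range t) := h ▸ Set.mem_univ x
      rcases hx with rfl | hx
      · simpa using hb
      · simp only [hx, Set.mem_compl_iff, Set.mem_singleton_iff, true_iff]
        rintro rfl
        exact hb hx
    · rintro (h | h)
      · exact absurd (h.symm ▸ Set.mem_univ b : b ∈ Set.range t) hb
      · rw [h, Set.insert_eq, Set.union_compl_self]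

/-- The functions with range `s` correspond to the surjections onto `s`. -/
noncomputable def rangeEqEquiv {α β : Type*} (s : Set β) :
    {t : α → β // Set.range t = s} ≃ {t : α → s // Function.Surjective t} where
  toFun t := ⟨fun a => ⟨t.1 a, t.2.subset (Set.mem_range_self a)⟩, by
    rintro ⟨x, hx⟩
    obtain ⟨a, ha⟩ : x ∈ Set.range t.1 := by rwa [t.2]
    exact ⟨a, Subtype.ext ha⟩⟩
  invFun t := ⟨fun a => t.1 a, by
    ext x
    constructor
    · rintro ⟨a, rfl⟩
      exact (t.1 a).2
    · intro hx
      obtain ⟨a, ha⟩ := t.2 ⟨x, hx⟩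
      exact ⟨a, congrArg Subtype.val ha⟩⟩
  left_inv _ := rfl
  right_inv _ := rfl

theorem card_surjective_congr {α β γ : Type*} (e : β ≃ γ) :
    Nat.card {t : α → β // Function.Surjective t} =
      Nat.card {t : α → γ // Function.Surjective t} := by
  refine Nat.card_congr ((Equiv.arrowCongr (Equiv.refl α) e).subtypeEquiv fun t => ?_)
  change _ ↔ Function.Surjective (e ∘ t ∘ id)
  exact (e.comp_surjective t).symm

theorem card_range_eq_compl_singleton (n k : ℕ) (b : Fin (k + 1)) :
    Nat.card {t : Fin n → Fin (k + 1) // Set.range t = {b}ᶜ} =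
      Nat.card {t : Fin n → Fin k // Function.Surjective t} := by
  rw [Nat.card_congr (rangeEqEquiv _)]
  refine card_surjective_congr (Fintype.equivFinOfCardEq ?_)
  rw [Fintype.card_compl_set, Fintype.card_fin, Set.card_singleton, Nat.add_sub_cancel]

/-- Condition on the image `b` of `0`: the remaining values either already cover everything or miss
exactly `b`. -/
theorem card_surjective_succ_succ (n k : ℕ) :
    Nat.card {t : Fin (n + 1) → Fin (k + 1) // Function.Surjective t} =
      (k + 1) * (Nat.card {t : Fin n → Fin (k + 1) // Function.Surjective t} +
        Nat.card {t : Fin n → Fin k // Function.Surjective t}) := by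
  classical
  have key (b : Fin (k + 1)) :
      Nat.card {t : Fin n → Fin (k + 1) //
        Function.Surjective (Fin.cons b t : Fin (n + 1) → Fin (k + 1))} =
      Nat.card {t : Fin n → Fin (k + 1) // Function.Surjective t} +
        Nat.card {t : Fin n → Fin k // Function.Surjective t} := by
    rw [← card_range_eq_compl_singleton n k b, ← Nat.card_sum]
    refine Nat.card_congr ((Equiv.subtypeEquivRight fun t => surjective_cons_iff b t).trans
      (subtypeOrEquiv _ _ ?_))
    rw [Pi.disjoint_iff]
    intro t
    rw [Prop.disjoint_iff]
    intro h
    have hb : b ∈ ({b}ᶜ : Set (Fin (k + 1))) := by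
      rw [← h.2, h.1.range_eq]
      exact Set.mem_univ b
    exact hb rfl
  have e : {t : Fin (n + 1) → Fin (k + 1) // Function.Surjective t} ≃
      (b : Fin (k + 1)) × {t : Fin n → Fin (k + 1) //
        Function.Surjective (Fin.cons b t : Fin (n + 1) → Fin (k + 1))} :=
    ((Fin.consEquiv fun _ => Fin (k + 1)).symm.subtypeEquiv
      (q := fun p => Function.Surjective (Fin.cons p.1 p.2 : Fin (n + 1) → Fin (k + 1)))
      fun t => by simp [Fin.consEquiv]).trans
      { toFun := fun p => ⟨p.1.1, p.1.2, p.2⟩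
        invFun := fun p => ⟨(p.1, p.2.1), p.2.2⟩
        left_inv := fun _ => rfl
        right_inv := fun _ => rfl }
  rw [Nat.card_congr e, Nat.card_sigma]
  simp only [key, Finset.sum_const, Finset.card_univ, Fintype.card_fin, smul_eq_mul]

theorem card_surjective_fin (n k : ℕ) :
    Nat.card {t : Fin n → Fin k // Function.Surjective t} =
      k.factorial * Nat.stirlingSecond n k := by
  induction n generalizing k with
  | zero =>
    cases k with
    | zero =>
      have : Unique {t : Fin 0 → Fin 0 // Function.Surjective t} :=
        ⟨⟨⟨id, Function.surjective_id⟩⟩, fun _ => Subsingleton.elim _ _⟩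
      rw [Nat.card_unique]
      simp
    | succ k =>
      have : IsEmpty {t : Fin 0 → Fin (k + 1) // Function.Surjective t} :=
        ⟨fun t => (t.2 0).elim fun x _ => x.elim0⟩
      simp
  | succ n ih =>
    cases k with
    | zero =>
      have : IsEmpty {t : Fin (n + 1) → Fin 0 // Function.Surjective t} :=
        ⟨fun t => (t.1 0).elim0⟩
      simp
    | succ k =>
      rw [card_surjective_succ_succ, ih, ih, Nat.stirlingSecond_succ_succ, Nat.factorial_succ]
      ring

/-! ### Ordered set partitions as surjections -/

namespace OrderedSetPartition

theorem level_surjective {α : Type*} (X : OrderedSetPartition α) :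
    Function.Surjective X.level := fun i => by
  obtain ⟨x, hx⟩ := X.block_nonempty i
  exact ⟨x, (X.mem_block_iff x i).mp hx⟩

/-- The ordered set partition whose levels are the fibers of a surjection. -/
def ofSurjective {α : Type*} [Fintype α] {k : ℕ} (f : α → Fin k)
    (hf : Function.Surjective f) : OrderedSetPartition α where
  height := k
  block i := Finset.univ.filter fun x => f x = i
  block_nonempty i := by
    obtain ⟨x, hx⟩ := hf i
    exact ⟨x, by simpa using hx⟩
  block_disjoint i j hij := by
    rw [Finset.disjoint_left]
    intro x hi hj
    simp only [Finset.mem_filter, Finset.mem_univ, true_and] at hi hj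
    exact hij (hi.symm.trans hj)
  exists_mem_block x := ⟨f x, by simp⟩

theorem level_ofSurjective {α : Type*} [Fintype α] {k : ℕ} (f : α → Fin k)
    (hf : Function.Surjective f) (x : α) : (ofSurjective f hf).level x = f x :=
  ((ofSurjective f hf).mem_block_iff x (f x)).mp (by simp [ofSurjective])

theorem ofSurjective_level {α : Type*} [Fintype α] (X : OrderedSetPartition α) :
    ofSurjective X.level X.level_surjective = X := by
  have hb : (fun i => Finset.univ.filter fun x => X.level x = i) = X.block := by
    ext i x
    simp [X.mem_block_iff]
  obtain ⟨h, b, _, _, _⟩ := X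
  simp only [ofSurjective, mk.injEq, heq_eq_eq, true_and]
  exact hb

/-- Ordered set partitions correspond to surjections onto some `Fin k`. -/
noncomputable def equivSurjective (α : Type*) [Fintype α] :
    OrderedSetPartition α ≃
      (k : Fin (Fintype.card α + 1)) × {f : α → Fin k // Function.Surjective f} where
  toFun X := ⟨⟨X.height, Nat.lt_succ_of_le X.height_le_card⟩, X.level, X.level_surjective⟩
  invFun p := ofSurjective p.2.1 p.2.2
  left_inv X := X.ofSurjective_level
  right_inv := by
    rintro ⟨k, f, hf⟩
    have h : (ofSurjective f hf).level = f := funext (level_ofSurjective f hf)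
    refine Sigma.ext (Fin.ext rfl) (heq_of_eq (Subtype.ext h))

end OrderedSetPartition

/-! ### Ordered Bell numbers and the mean rank -/

theorem orderedBell_eq_sum (n : ℕ) :
    orderedBell n = ∑ k ∈ Finset.range (n + 1), k.factorial * Nat.stirlingSecond n k := by
  rw [orderedBell, ← Nat.card_eq_fintype_card,
    Nat.card_congr (OrderedSetPartition.equivSurjective (Fin n)), Nat.card_sigma,
    Finset.sum_range, Fintype.card_fin]
  exact Finset.sum_congr rfl fun k _ => card_surjective_fin n k

/-- By the symmetry of reversal, the average value of a surjection onto `Fin k` is `(k + 1) / 2`. -/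
theorem sum_surjective_sum_succ (n k : ℕ) [Fintype {f : Fin n → Fin k // Function.Surjective f}] :
    ∑ f : {f : Fin n → Fin k // Function.Surjective f}, ∑ x, (((f.1 x : ℕ) : ℝ) + 1) =
      n * ((k + 1).factorial * Nat.stirlingSecond n k) / 2 := by
  let e : {f : Fin n → Fin k // Function.Surjective f} ≃
      {f : Fin n → Fin k // Function.Surjective f} :=
    (Equiv.arrowCongr (Equiv.refl (Fin n)) Fin.revPerm).subtypeEquiv fun t => by
      change _ ↔ Function.Surjective (Fin.revPerm ∘ t ∘ id)
      exact (Fin.revPerm.comp_surjective t).symm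
  have he := Equiv.sum_comp e fun f => ∑ x, (((f.1 x : ℕ) : ℝ) + 1)
  have hadd : ∀ f : {f : Fin n → Fin k // Function.Surjective f},
      ∑ x, (((f.1 x : ℕ) : ℝ) + 1) + ∑ x, ((((e f).1 x : ℕ) : ℝ) + 1) = n * (k + 1) := by
    intro f
    rw [← Finset.sum_add_distrib]
    have : ∀ x, ((f.1 x : ℕ) : ℝ) + 1 + ((((e f).1 x : ℕ) : ℝ) + 1) = k + 1 := by
      intro x
      have h1 : (((e f).1 x : Fin k) : ℕ) = k - (f.1 x + 1) := Fin.val_rev (f.1 x)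
      have h2 : (f.1 x : ℕ) + 1 ≤ k := (f.1 x).2
      rw [h1, Nat.cast_sub h2]
      push_cast
      ring
    simp only [this, Finset.sum_const, Finset.card_univ, Fintype.card_fin, nsmul_eq_mul]
  have hcard : (Fintype.card {f : Fin n → Fin k // Function.Surjective f} : ℝ) =
      k.factorial * Nat.stirlingSecond n k := by
    rw [← Nat.card_eq_fintype_card, card_surjective_fin]
    push_cast
    ring
  have hsum := Finset.sum_congr (rfl : Finset.univ = Finset.univ) fun f _ => hadd f
  rw [Finset.sum_add_distrib, he, Finset.sum_const, Finset.card_univ, nsmul_eq_mul, hcard] at hsum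
  rw [Nat.factorial_succ]
  push_cast
  linarith

theorem sum_rank (n : ℕ) :
    ∑ X : OrderedSetPartition (Fin n), ∑ x : Fin n, (X.rank x : ℝ) =
      n * (∑ k ∈ Finset.range (n + 1), ((k + 1).factorial : ℝ) * Nat.stirlingSecond n k) / 2 := by
  classical
  have h := Equiv.sum_comp (OrderedSetPartition.equivSurjective (Fin n)).symm
    fun X => ∑ x : Fin n, (X.rank x : ℝ)
  rw [← h, Fintype.sum_sigma, Finset.mul_sum, Finset.sum_div, Finset.sum_range]
  have hr : ∀ (k : Fin (Fintype.card (Fin n) + 1)) (f : {f : Fin n → Fin k //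
      Function.Surjective f}) (x : Fin n),
      ((((OrderedSetPartition.equivSurjective (Fin n)).symm ⟨k, f⟩).rank x : ℕ) : ℝ) =
        ((f.1 x : ℕ) : ℝ) + 1 := by
    intro k f x
    have : ((OrderedSetPartition.equivSurjective (Fin n)).symm ⟨k, f⟩).level x = f.1 x :=
      OrderedSetPartition.level_ofSurjective f.1 f.2 x
    rw [OrderedSetPartition.rank, this]
    push_cast
    rfl
  simp only [hr, sum_surjective_sum_succ]
  exact (Fin.sum_congr' (fun k : Fin (n + 1) =>
    (n : ℝ) * (((k : ℕ) + 1).factorial * Nat.stirlingSecond n k) / 2)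
    (by rw [Fintype.card_fin]))

theorem orderedBell_pos (n : ℕ) : 0 < orderedBell n := by
  rw [orderedBell_eq_sum]
  exact Finset.sum_pos' (fun _ _ => Nat.zero_le _)
    ⟨n, by simp, by simp [Nat.stirlingSecond_self, Nat.factorial_pos]⟩

theorem averageRank_mul_orderedBell {n : ℕ} (hn : 1 ≤ n) :
    averageRank n * orderedBell n =
      (∑ k ∈ Finset.range (n + 1), ((k + 1).factorial : ℝ) * Nat.stirlingSecond n k) / 2 := by
  have hB : (orderedBell n : ℝ) ≠ 0 := Nat.cast_ne_zero.mpr (orderedBell_pos n).ne'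
  have hn' : (n : ℝ) ≠ 0 := Nat.cast_ne_zero.mpr (by omega)
  rw [averageRank, sum_rank]
  field_simp

/-- The Stirling recurrence splits `B_{n+1}` into the sums of `k · k! S(n,k)` and of `(k+1)!
S(n,k)`; adding `B_n` turns the first into a second copy of the latter. -/
theorem orderedBell_succ_add (n : ℕ) :
    orderedBell (n + 1) + orderedBell n =
      2 * ∑ k ∈ Finset.range (n + 1), (k + 1).factorial * Nat.stirlingSecond n k := by
  have h1 : orderedBell (n + 1) = ∑ k ∈ Finset.range (n + 1),
      (k + 1).factorial * ((k + 1) * Nat.stirlingSecond n (k + 1) + Nat.stirlingSecond n k) := by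
    rw [orderedBell_eq_sum, Finset.sum_range_succ']
    simp [Nat.stirlingSecond_succ_succ]
  have h2 : ∑ k ∈ Finset.range (n + 1), (k + 1).factorial * ((k + 1) * Nat.stirlingSecond n (k + 1))
      = ∑ k ∈ Finset.range (n + 1), k * (k.factorial * Nat.stirlingSecond n k) := by
    have := Finset.sum_range_succ' (fun k => k * (k.factorial * Nat.stirlingSecond n k)) (n + 1)
    -- The index shift costs nothing: the new top term has `S(n,n+1) = 0` and the bottom term has
    -- the factor `k = 0`.
    rw [Finset.sum_range_succ, Nat.stirlingSecond_eq_zero_of_lt (Nat.lt_succ_self n)] at this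
    simp only [mul_zero, zero_mul, add_zero] at this
    rw [this]
    exact Finset.sum_congr rfl fun k _ => by ring
  simp only [h1, mul_add, Finset.sum_add_distrib] at h2 ⊢
  rw [h2, orderedBell_eq_sum, add_right_comm, ← Finset.sum_add_distrib, two_mul]
  congr 1
  exact Finset.sum_congr rfl fun k _ => by rw [Nat.factorial_succ]; ring

/-- This fails at `n = 0`, where the left side is `0` and the right side `1/2`. -/
theorem averageRank_mul_orderedBell_eq {n : ℕ} (hn : 1 ≤ n) :
    averageRank n * orderedBell n = ((orderedBell (n + 1) : ℝ) + orderedBell n) / 4 := by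
  have h : ((orderedBell (n + 1) + orderedBell n : ℕ) : ℝ) = _ :=
    congrArg Nat.cast (orderedBell_succ_add n)
  push_cast at h
  rw [averageRank_mul_orderedBell hn, h]
  ring

theorem averageRank_eq {n : ℕ} (hn : 1 ≤ n) :
    averageRank n = 1 / (2 * (orderedBell n : ℝ)) *
      ∑ i ∈ Finset.Icc 1 n, ((i + 1).factorial : ℝ) * (Nat.stirlingSecond n i : ℝ) := by
  have hB : (orderedBell n : ℝ) ≠ 0 := Nat.cast_ne_zero.mpr (orderedBell_pos n).ne'
  have h := averageRank_mul_orderedBell hn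
  rw [Finset.range_eq_Ico, Finset.sum_eq_sum_Ico_succ_bot (Nat.succ_pos n)] at h
  obtain ⟨m, rfl⟩ := Nat.exists_eq_add_of_le' hn
  rw [Nat.stirlingSecond_succ_zero, Nat.cast_zero, mul_zero, zero_add, zero_add, Nat.succ_eq_add_one,
    Finset.Ico_add_one_right_eq_Icc] at h
  rw [eq_div_iff two_ne_zero] at h
  rw [← h]
  field_simp

/-! ### Exponential generating functions -/

open PowerSeries in
-- Writing `e^x = (e^x - 1) + 1` in the derivative of `(e^x - 1)^(k+1)` reproduces the Stirling
-- recurrence.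
theorem coeff_exp_sub_one_pow (n k : ℕ) :
    coeff n ((exp ℝ - 1) ^ k) =
      (k.factorial * Nat.stirlingSecond n k : ℝ) / n.factorial := by
  induction n generalizing k with
  | zero =>
    cases k <;> simp
  | succ n ih =>
    cases k with
    | zero => simp [coeff_one]
    | succ k =>
      have hd : derivative ℝ ((exp ℝ - 1) ^ (k + 1)) =
          (k + 1 : ℝ) • ((exp ℝ - 1) ^ (k + 1) + (exp ℝ - 1) ^ k) := by
        rw [Derivation.leibniz_pow, map_sub, derivative_exp, Derivation.map_one_eq_zero,
          Nat.add_sub_cancel, smul_eq_mul, ← Nat.cast_smul_eq_nsmul ℝ]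
        push_cast
        congr 1
        ring
      have hc := congrArg (coeff n) hd
      rw [coeff_derivative, coeff_smul, map_add, ih, ih] at hc
      have hn : (n + 1 : ℝ) ≠ 0 := by positivity
      have hf : (n.factorial : ℝ) ≠ 0 := by positivity
      rw [eq_div_iff (by positivity), Nat.stirlingSecond_succ_succ, Nat.factorial_succ,
        Nat.factorial_succ]
      push_cast
      rw [Nat.factorial_succ] at hc
      push_cast at hc
      rw [← mul_assoc, hc, smul_eq_mul]
      field_simp

/-- The exponential generating function of the ordered Bell numbers. -/
noncomputable def orderedBellSeries : PowerSeries ℝ :=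
  PowerSeries.mk fun n => (orderedBell n : ℝ) / n.factorial

open PowerSeries in
-- Since `(e^x - 1)^k` has order `k`, a finite geometric sum can replace the infinite one in each
-- coefficient.
theorem coeff_orderedBellSeries_eq {n N : ℕ} (h : n < N) :
    coeff n orderedBellSeries = coeff n (∑ k ∈ Finset.range N, (exp ℝ - 1) ^ k) := by
  rw [orderedBellSeries, coeff_mk, map_sum, orderedBell_eq_sum, Nat.cast_sum, Finset.sum_div]
  simp only [coeff_exp_sub_one_pow]
  push_cast
  refine Finset.sum_subset (Finset.range_subset_range.mpr h) fun k _ hk => ?_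
  rw [Nat.stirlingSecond_eq_zero_of_lt (by simpa using hk)]
  simp

open PowerSeries in
theorem orderedBellSeries_mul : orderedBellSeries * (2 - exp ℝ) = 1 := by
  ext n
  have h : coeff n (orderedBellSeries * (2 - exp ℝ)) =
      coeff n ((∑ k ∈ Finset.range (n + 1), (exp ℝ - 1) ^ k) * (2 - exp ℝ)) := by
    rw [coeff_mul, coeff_mul]
    refine Finset.sum_congr rfl fun p hp => ?_
    rw [coeff_orderedBellSeries_eq (N := n + 1)]
    have := Finset.HasAntidiagonal.mem_antidiagonal.mp hp
    omega
  have hg : (∑ k ∈ Finset.range (n + 1), (exp ℝ - 1) ^ k) * (2 - exp ℝ) =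
      1 - (exp ℝ - 1) ^ (n + 1) := by
    rw [← geom_sum_mul_neg]
    congr 1
    ring
  rw [h, hg, map_sub, coeff_exp_sub_one_pow, Nat.stirlingSecond_eq_zero_of_lt (Nat.lt_succ_self n)]
  simp

open PowerSeries in
theorem averageRank_series :
    (PowerSeries.mk fun n : ℕ => averageRank n * (orderedBell n : ℝ) / (n.factorial : ℝ)) =
      -C (1 / 2 : ℝ) * ((exp ℝ - 1) * (exp ℝ - 3)) * ((exp ℝ - 2) ^ 2)⁻¹ := by
  have hE := orderedBellSeries_mul
  have hD : derivative ℝ orderedBellSeries * (2 - exp ℝ) = orderedBellSeries * exp ℝ := by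
    have h := congrArg (derivative ℝ) hE
    have h2 : derivative ℝ (2 : PowerSeries ℝ) = 0 := by
      simpa using (derivative ℝ).map_natCast 2
    rw [Derivation.leibniz, map_sub, derivative_exp, Derivation.map_one_eq_zero, h2, smul_eq_mul,
      smul_eq_mul] at h
    linear_combination h
  -- The constant `1/2` corrects the term `n = 0`, where `(B_1 + B_0)/4 = 1/2` but `a_0 = 0`.
  have hA : (PowerSeries.mk fun n : ℕ => averageRank n * (orderedBell n : ℝ) / (n.factorial : ℝ)) =
      C (1 / 4 : ℝ) * (derivative ℝ orderedBellSeries + orderedBellSeries) - C (1 / 2 : ℝ) := by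
    ext n
    rw [coeff_mk, map_sub, coeff_C_mul, map_add, coeff_derivative, coeff_C]
    simp only [orderedBellSeries, coeff_mk]
    rcases Nat.eq_zero_or_pos n with rfl | hn
    · simp [averageRank, orderedBell_eq_sum, Finset.sum_range_succ]
      norm_num [Nat.stirlingSecond_self]
    · rw [averageRank_mul_orderedBell_eq hn, if_neg hn.ne', Nat.factorial_succ]
      have : (n + 1 : ℝ) ≠ 0 := by positivity
      have hf : (n.factorial : ℝ) ≠ 0 := by positivity
      push_cast
      field_simp
      ring
  have hc : constantCoeff ((exp ℝ - 2) ^ 2) ≠ 0 := by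
    rw [map_pow, map_sub, constantCoeff_exp, map_ofNat]
    norm_num
  rw [PowerSeries.eq_mul_inv_iff_mul_eq hc, hA]
  have h4 : (C (1 / 4 : ℝ) : PowerSeries ℝ) * 4 = 1 := by
    rw [show (4 : PowerSeries ℝ) = C (4 : ℝ) from (map_ofNat C 4).symm, ← map_mul]
    norm_num
  have h2 : (C (1 / 2 : ℝ) : PowerSeries ℝ) = C (1 / 4 : ℝ) * 2 := by
    rw [show (2 : PowerSeries ℝ) = C (2 : ℝ) from (map_ofNat C 2).symm, ← map_mul]
    norm_num
  rw [h2]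
  linear_combination (C (1 / 4 : ℝ) * (2 - exp ℝ)) * hD + 2 * C (1 / 4 : ℝ) * hE

/-! ### Removing the singularity at `log 2` -/

/-- The Taylor series at `0` of a complex function. -/
noncomputable def taylorSeriesZero (f : ℂ → ℂ) : PowerSeries ℂ :=
  PowerSeries.mk fun n => iteratedDeriv n f 0 / n.factorial

open PowerSeries in
theorem taylorSeriesZero_mul {f g : ℂ → ℂ} (hf : AnalyticAt ℂ f 0) (hg : AnalyticAt ℂ g 0) :
    taylorSeriesZero (f * g) = taylorSeriesZero f * taylorSeriesZero g := by
  ext n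
  simp only [taylorSeriesZero, coeff_mk, coeff_mul]
  rw [iteratedDeriv_mul hf.contDiffAt hg.contDiffAt,
    Finset.Nat.sum_antidiagonal_eq_sum_range_succ_mk, Finset.sum_div]
  refine Finset.sum_congr rfl fun i hi => ?_
  rw [Nat.cast_choose _ (by simpa [Nat.lt_succ_iff] using hi)]
  have hn : (n.factorial : ℂ) ≠ 0 := Nat.cast_ne_zero.mpr n.factorial_ne_zero
  field_simp

open PowerSeries in
theorem taylorSeriesZero_two_sub_exp :
    taylorSeriesZero (fun z => 2 - Complex.exp z) = 2 - exp ℂ := by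
  ext n
  have h2 : (2 : PowerSeries ℂ) = C (2 : ℂ) := (map_ofNat C 2).symm
  rcases Nat.eq_zero_or_pos n with rfl | hn
  · simp [taylorSeriesZero, h2]
  · rw [taylorSeriesZero, coeff_mk, iteratedDeriv_const_sub hn, iteratedDeriv_neg,
      iteratedDeriv_eq_iterate, Complex.iter_deriv_exp, h2, map_sub, coeff_C, if_neg hn.ne',
      coeff_exp]
    simp [neg_div]

open PowerSeries in
theorem taylorSeriesZero_const_sub (a : ℂ) :
    taylorSeriesZero (fun z => a - z) = C a - X := by
  ext n
  rcases Nat.eq_zero_or_pos n with rfl | hn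
  · simp [taylorSeriesZero]
  · rw [taylorSeriesZero, coeff_mk, iteratedDeriv_const_sub hn, map_sub, coeff_C, if_neg hn.ne',
      coeff_X, iteratedDeriv_neg, iteratedDeriv_eq_iterate]
    obtain ⟨m, rfl⟩ := Nat.exists_eq_add_of_le' hn
    rw [Function.iterate_succ_apply]
    rcases Nat.eq_zero_or_pos m with rfl | hm
    · simp
    · obtain ⟨l, rfl⟩ := Nat.exists_eq_add_of_le' hm
      simp [Function.iterate_succ_apply, ← iteratedDeriv_eq_iterate]

/-- A zero away from `log 2` would solve `e^z = 2`, but the other solutions `log 2 + 2πik` lie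
outside the unit disc. -/
theorem dslope_exp_ne_zero {z : ℂ} (hz : z ∈ Metric.ball (0 : ℂ) 1) :
    dslope Complex.exp (Real.log 2 : ℂ) z ≠ 0 := by
  by_cases h : z = (Real.log 2 : ℂ)
  · rw [h, dslope_same, Complex.deriv_exp]
    exact Complex.exp_ne_zero _
  · intro h0
    have := sub_smul_dslope Complex.exp (Real.log 2 : ℂ) z
    rw [h0, smul_zero, eq_comm, sub_eq_zero, Complex.exp_eq_exp_iff_exists_int] at this
    obtain ⟨k, hk⟩ := this
    have him := congrArg Complex.im hk
    simp [-Complex.ofNat_log] at him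
    have hlt : |z.im| < 1 := (Complex.abs_im_le_norm z).trans_lt (by simpa using hz)
    rcases eq_or_ne k 0 with rfl | hk0
    · exact h (by simpa using hk)
    · have h1 : (1 : ℝ) ≤ |(k : ℝ)| := by exact_mod_cast Int.one_le_abs hk0
      rw [him, abs_mul, abs_of_pos Real.two_pi_pos] at hlt
      nlinarith [Real.pi_gt_three]

/-- The quotient `(log 2 - z) / (2 - exp z)`, extended to the removable singularity `log 2`. -/
noncomputable def regularPart (z : ℂ) : ℂ := (dslope Complex.exp (Real.log 2 : ℂ) z)⁻¹

theorem differentiableOn_regularPart : DifferentiableOn ℂ regularPart (Metric.ball 0 1) := by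
  have h : DifferentiableOn ℂ (dslope Complex.exp (Real.log 2 : ℂ)) Set.univ :=
    (Complex.differentiableOn_dslope univ_mem).mpr Complex.differentiable_exp.differentiableOn
  exact (h.mono (Set.subset_univ _)).inv fun z hz => dslope_exp_ne_zero hz

theorem cexp_log_two : Complex.exp (Real.log 2 : ℂ) = 2 := by
  rw [← Complex.ofReal_exp, Real.exp_log two_pos, Complex.ofReal_ofNat]

theorem regularPart_mul {z : ℂ} (hz : z ∈ Metric.ball (0 : ℂ) 1) :
    regularPart z * (2 - Complex.exp z) = Real.log 2 - z := by
  have h := sub_smul_dslope Complex.exp (Real.log 2 : ℂ) z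
  rw [cexp_log_two, smul_eq_mul] at h
  have h0 := dslope_exp_ne_zero hz
  rw [regularPart, inv_mul_eq_iff_eq_mul₀ h0]
  linear_combination h

theorem regularPart_log_two : regularPart (Real.log 2 : ℂ) = 1 / 2 := by
  rw [regularPart, dslope_same, Complex.deriv_exp, cexp_log_two, one_div]

open PowerSeries in
theorem taylorSeriesZero_regularPart :
    taylorSeriesZero regularPart =
      (C (Real.log 2 : ℂ) - X) * PowerSeries.map Complex.ofRealHom orderedBellSeries := by
  have hball : Metric.ball (0 : ℂ) 1 ∈ nhds 0 := Metric.ball_mem_nhds _ one_pos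
  have hG : AnalyticAt ℂ regularPart 0 := differentiableOn_regularPart.analyticAt hball
  have hE : AnalyticAt ℂ (fun z : ℂ => 2 - Complex.exp z) 0 := by fun_prop
  have h1 : taylorSeriesZero regularPart * (2 - exp ℂ) = C (Real.log 2 : ℂ) - X := by
    rw [← taylorSeriesZero_two_sub_exp, ← taylorSeriesZero_mul hG hE,
      ← taylorSeriesZero_const_sub]
    ext n
    rw [taylorSeriesZero, taylorSeriesZero, coeff_mk, coeff_mk]
    congr 1
    refine Filter.EventuallyEq.iteratedDeriv_eq n ?_
    filter_upwards [hball] with z hz using regularPart_mul hz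
  have h2 : PowerSeries.map Complex.ofRealHom orderedBellSeries * (2 - exp ℂ) = 1 := by
    have := congrArg (PowerSeries.map Complex.ofRealHom) orderedBellSeries_mul
    rwa [map_mul, map_sub, map_exp, map_one, map_ofNat] at this
  rw [← h1, mul_assoc, mul_comm (2 - exp ℂ), h2, mul_one]

/-- With `b_k = B_k / k!`, the `k`-th coefficient is `b_k log 2 - b_{k-1}` for `k ≥ 1`, so the sum
telescopes. -/
theorem sum_taylor_regularPart (n : ℕ) :
    ∑ k ∈ Finset.range (n + 1),
      PowerSeries.coeff k (taylorSeriesZero regularPart) * (Real.log 2 : ℂ) ^ k =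
      ((orderedBell n / n.factorial * Real.log 2 ^ (n + 1) : ℝ) : ℂ) := by
  rw [taylorSeriesZero_regularPart]
  induction n with
  | zero =>
    simp [orderedBellSeries, sub_mul, mul_comm]
  | succ n ih =>
    rw [Finset.sum_range_succ, ih]
    simp only [sub_mul, map_sub, PowerSeries.coeff_C_mul, PowerSeries.coeff_succ_X_mul,
      PowerSeries.coeff_map, orderedBellSeries, PowerSeries.coeff_mk, Complex.ofRealHom_eq_coe]
    push_cast
    ring

theorem log_two_mem_ball : (Real.log 2 : ℂ) ∈ Metric.ball (0 : ℂ) 1 := by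
  rw [mem_ball_zero_iff, Complex.norm_real, Real.norm_of_nonneg (Real.log_nonneg one_le_two)]
  linarith [Real.log_two_lt_d9]

/-! ### Asymptotics -/

theorem tendsto_orderedBell :
    Tendsto (fun n : ℕ => (orderedBell n : ℝ) / n.factorial * Real.log 2 ^ (n + 1)) atTop
      (nhds (1 / 2)) := by
  have h := (Complex.hasSum_taylorSeries_on_ball differentiableOn_regularPart
    log_two_mem_ball).tendsto_sum_nat
  rw [regularPart_log_two] at h
  have h' := (tendsto_add_atTop_iff_nat 1).mpr h
  have hc : (fun n : ℕ => ∑ k ∈ Finset.range (n + 1), (k.factorial : ℂ)⁻¹ •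
      ((Real.log 2 : ℂ) - 0) ^ k • iteratedDeriv k regularPart 0) =
      fun n => ((orderedBell n / n.factorial * Real.log 2 ^ (n + 1) : ℝ) : ℂ) := by
    funext n
    rw [← sum_taylor_regularPart]
    refine Finset.sum_congr rfl fun k _ => ?_
    rw [taylorSeriesZero, PowerSeries.coeff_mk, sub_zero, smul_eq_mul, smul_eq_mul]
    ring
  rw [hc] at h'
  have := (Complex.continuous_re.tendsto _).comp h'
  simpa [Function.comp_def, -Complex.ofReal_mul, -Complex.ofReal_div] using this

theorem isEquivalent_orderedBell :
    (fun n : ℕ => (orderedBell n : ℝ)) ~[atTop]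
      fun n : ℕ => (n.factorial : ℝ) / (2 * Real.log 2 ^ (n + 1)) := by
  have hL : 0 < Real.log 2 := Real.log_pos one_lt_two
  refine isEquivalent_of_tendsto_one ?_
  have h := tendsto_orderedBell.const_mul 2
  rw [mul_one_div_cancel two_ne_zero] at h
  refine h.congr fun n => ?_
  have hf : (n.factorial : ℝ) ≠ 0 := by positivity
  simp only [Pi.div_apply]
  field_simp

theorem isEquivalent_averageRank_mul_orderedBell :
    (fun n : ℕ => averageRank n * (orderedBell n : ℝ)) ~[atTop]
      fun n : ℕ => (n.factorial : ℝ) * ((n : ℝ) / (8 * Real.log 2 ^ (n + 2))) := by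
  have hL : 0 < Real.log 2 := Real.log_pos one_lt_two
  refine isEquivalent_of_tendsto_one ?_
  have hinv : Tendsto (fun n : ℕ => 1 / (n : ℝ)) atTop (nhds 0) :=
    tendsto_one_div_atTop_nhds_zero_nat
  -- With `L = log 2` and `b_n = B_n / n!`, the ratio is `2 (b_{n+1} L^(n+2) (1 + 1/n) + b_n L^(n+1)
  -- · L/n)`; only the first term survives.
  have h1 := ((tendsto_add_atTop_iff_nat 1).mpr tendsto_orderedBell).mul (hinv.const_add 1)
  have h2 := tendsto_orderedBell.mul (hinv.mul_const (Real.log 2))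
  have h := (h1.add h2).const_mul 2
  have hv : (2 : ℝ) * (1 / 2 * (1 + 0) + 1 / 2 * (0 * Real.log 2)) = 1 := by norm_num
  rw [hv] at h
  refine h.congr' ?_
  filter_upwards [eventually_ge_atTop 1] with n hn
  have hf : (n.factorial : ℝ) ≠ 0 := by positivity
  have hn' : (n : ℝ) ≠ 0 := Nat.cast_ne_zero.mpr (by omega)
  simp only [Pi.div_apply]
  rw [averageRank_mul_orderedBell_eq hn, Nat.factorial_succ]
  push_cast
  field_simp
  ring

theorem isEquivalent_averageRank :
    averageRank ~[atTop] fun n : ℕ => (n : ℝ) / (4 * Real.log 2) := by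
  have hL : 0 < Real.log 2 := Real.log_pos one_lt_two
  have h := isEquivalent_averageRank_mul_orderedBell.div isEquivalent_orderedBell
  refine (h.congr_left (Eventually.of_forall fun n => ?_)).congr_right
    (Eventually.of_forall fun n => ?_)
  · exact mul_div_cancel_right₀ _ (Nat.cast_ne_zero.mpr (orderedBell_pos n).ne')
  · have hf : (n.factorial : ℝ) ≠ 0 := by positivity
    simp only [Pi.div_apply]
    field_simp
    ring

theorem mainTheorem4 :
    -- the exact value of the expected rank
    (∀ n : ℕ, 1 ≤ n →
      averageRank n = 1 / (2 * (orderedBell n : ℝ)) *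
        ∑ i ∈ Finset.Icc 1 n, ((i + 1).factorial : ℝ) * (Nat.stirlingSecond n i : ℝ)) ∧
    -- the exponential generating function of `a_n B_n`, as a formal power series
    (PowerSeries.mk fun n : ℕ => averageRank n * (orderedBell n : ℝ) / (n.factorial : ℝ)) =
      -PowerSeries.C (1 / 2 : ℝ) * ((PowerSeries.exp ℝ - 1) * (PowerSeries.exp ℝ - 3)) *
        ((PowerSeries.exp ℝ - 2) ^ 2)⁻¹ ∧
    -- the asymptotics of `B_n`, of `a_n B_n` and of `a_n`
    ((fun n : ℕ => (orderedBell n : ℝ)) ~[atTop]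
      fun n : ℕ => (n.factorial : ℝ) / (2 * Real.log 2 ^ (n + 1))) ∧
    ((fun n : ℕ => averageRank n * (orderedBell n : ℝ)) ~[atTop]
      fun n : ℕ => (n.factorial : ℝ) * ((n : ℝ) / (8 * Real.log 2 ^ (n + 2)))) ∧
    (averageRank ~[atTop] fun n : ℕ => (n : ℝ) / (4 * Real.log 2)) ∧
    -- the numerical value of the constant
    (0.36067 : ℝ) ≤ 1 / (4 * Real.log 2) ∧ 1 / (4 * Real.log 2) < (0.36068 : ℝ) := by
  have hL : 0 < Real.log 2 := Real.log_pos one_lt_two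
  refine ⟨fun n hn => averageRank_eq hn, averageRank_series, isEquivalent_orderedBell,
    isEquivalent_averageRank_mul_orderedBell, isEquivalent_averageRank, ?_, ?_⟩
  · rw [le_div_iff₀ (by positivity)]
    linarith [Real.log_two_lt_d9]
  · rw [div_lt_iff₀ (by positivity)]
    linarith [Real.log_two_gt_d9]
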